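/- Let $\mathcal H=\mathcal H(Z,\bar Z):\mathbb C\to\mathbb R$ be of class $C^{3,1}_{loc}$ and equip $\mathbb R^4$ with coordinates $(U,V,Z,\bar Z)$, where $U,V\in\mathbb R$ and $Z=x+iy\in\mathbb C$. Let $g$ be the impulsive gravitational wave metric with profile $\mathcal H$ and cosmological constant $\Lambda=0$, \[ g = 2\,\bigl|dZ+U^+(\partial^2_{Z,\bar Z}\mathcal H\,dZ+\partial^2_{\bar Z,\bar Z}\mathcal H\,d\bar Z)\bigr|^2-2\,dU\,dV,\qquad U^+=\max(0,U), \] and let $M_0\subseteq\mathbb R^4$ be the set of points where $g$ has Lorentzian signature. A tangent vector $w$ at a point is future directed causal if $w\neq0$, $g(w,w)\le 0$ and $g(\partial_U+\partial_V,w)<0$. For $M\subseteq\mathbb R^4$, a future directed causal curve in $M$ is a locally Lipschitz curve $\gamma:I\to M$, $I$ an interval, whose velocity is future directed causal almost everywhere; its length is $L_g(\gamma)=\int_I\sqrt{-g(\dot\gamma_t,\dot\gamma_t)}\,dt$. The time separation $\tau_M(p,q)\in[0,\infty]$ is the supremum of $L_g$ over all future directed causal curves $[0,1]\to M$ from $p$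 to $q$ (and $0$ if there are none), and $p\ll_M q$ means $\tau_M(p,q)>0$. These definitions are applied verbatim also at points where $g$ degenerates. Then the curve $\gamma_t=\tfrac1{\sqrt2}(t,t,0,0)$, $t\in\mathbb R$, has the following properties. (a) $\gamma:\mathbb R\to\mathbb R^4$ is a complete timelike line of $(\mathbb R^4,g)$: it is a future directed causal curve with $g(\dot\gamma_t,\dot\gamma_t)<0$ for almost every $t$, and for all real $s<t$ one has $\gamma_s\ll_{\mathbb R^4}\gamma_t$ and \[ L_g(\gamma|_{[s,t]})=\tau_{\mathbb R^4}(\gamma_s,\gamma_t)=t-s , \] so that $\gamma$ is parametrised by proper time ranging over all of $\mathbb R$ and maximises length between any two of its points. (b) For every interval $I\subseteq\mathbb R$ with $\gamma(I)\subseteq M_0$, the curve $\gamma|_I$ has the same properties in $(M_0,g)$: it is a future directed causal curve in $M_0$ with $g(\dot\gamma_t,\dot\gamma_t)<0$ for almost every $t\in I$, and for all $s<t$ in $I$ one has $\gamma_s\ll_{M_0}\gamma_t$ and $L_g(\gamma|_{[s,t]})=\tau_{M_0}(\gamma_s,\gamma_t)=t-s$. In particular, if $\gamma(\mathbb R)\subseteq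 M_0$, then $\gamma$ is a complete timelike line of $(M_0,g)$. -/

import Mathlib

noncomputable section

open MeasureTheory Set
open scoped NNReal ENNReal ComplexConjugate

namespace ImpulsiveWave

/-- Coordinate space `ℝ⁴` with coordinates `(U, V, Z)`, where `U, V` are real and `Z = x + i y`
is complex; the conjugate coordinate is the complex conjugate of `Z`. -/
abbrev Spacetime : Type := ℝ × ℝ × ℂ

/-- The coordinate `U`. -/
def coordU (p : Spacetime) : ℝ := p.1

/-- The coordinate `V`. -/
def coordV (p : Spacetime) : ℝ := p.2.1

/-- The coordinate `Z`. -/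
def coordZ (p : Spacetime) : ℂ := p.2.2

/-- Regularity `C^{3,1}_loc` of a real-valued function of `(Z, conj Z)`, that is, of the real
variables `x, y` with `Z = x + i y`. -/
def IsC31Loc (H : ℂ → ℝ) : Prop :=
  ContDiff ℝ 3 H ∧ LocallyLipschitz (iteratedFDeriv ℝ 3 H)

/-- The Wirtinger derivative `∂_Z f = (∂_x f - i ∂_y f) / 2`. -/
def dZ (f : ℂ → ℂ) (z : ℂ) : ℂ :=
  (fderiv ℝ f z 1 - Complex.I * fderiv ℝ f z Complex.I) / 2

/-- The Wirtinger derivative with respect to `conj Z`, namely `(∂_x f + i ∂_y f) / 2`. -/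
def dZbar (f : ℂ → ℂ) (z : ℂ) : ℂ :=
  (fderiv ℝ f z 1 + Complex.I * fderiv ℝ f z Complex.I) / 2

/-- A real-valued profile regarded as a complex-valued function. -/
def toComplexFun (H : ℂ → ℝ) : ℂ → ℂ := fun z => (H z : ℂ)

/-- `∂²H / ∂Z ∂(conj Z)`. -/
def hessZZbar (H : ℂ → ℝ) : ℂ → ℂ := dZ (dZbar (toComplexFun H))

/-- `∂²H / ∂(conj Z)²`. -/
def hessZbarZbar (H : ℂ → ℝ) : ℂ → ℂ := dZbar (dZbar (toComplexFun H))

/-- `G = H - Z ∂_Z H - (conj Z) ∂_{conj Z} H`, which is real. -/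
def profileG (H : ℂ → ℝ) (z : ℂ) : ℝ :=
  (toComplexFun H z - z * dZ (toComplexFun H) z - conj z * dZbar (toComplexFun H) z).re

/-- `U⁺ = max (0, U)`. -/
def Uplus (p : Spacetime) : ℝ := max 0 (coordU p)

/-- The value on the tangent vector `v` at `p` of the complex one-form
`dZ + U⁺ (∂²H/∂Z∂(conj Z) dZ + ∂²H/∂(conj Z)² d(conj Z))`. -/
def coframe (H : ℂ → ℝ) (p v : Spacetime) : ℂ :=
  coordZ v + (Uplus p : ℂ) * (hessZZbar H (coordZ p) * coordZ v
    + hessZbarZbar H (coordZ p) * conj (coordZ v))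

/-- The conformal factor `1 + (Λ / 6) (Z conj Z - U V - U⁺ G)`. -/
def conformalP (Λ : ℝ) (H : ℂ → ℝ) (p : Spacetime) : ℝ :=
  1 + Λ / 6 * (Complex.normSq (coordZ p) - coordU p * coordV p
    - Uplus p * profileG H (coordZ p))

/-- The metric of the impulsive wave with profile `H` and cosmological constant `Λ`,
`ds² = (2 |dZ + U⁺ (∂²H/∂Z∂(conj Z) dZ + ∂²H/∂(conj Z)² d(conj Z))|² - 2 dU dV) / P²`,
as a symmetric bilinear form on each tangent space. -/
def waveMetric (Λ : ℝ) (H : ℂ → ℝ) (p : Spacetime) : LinearMap.BilinForm ℝ Spacetime :=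
  LinearMap.mk₂ ℝ
    (fun v w => (2 * (coframe H p v * conj (coframe H p w)).re
      - (coordU v * coordV w + coordV v * coordU w)) / conformalP Λ H p ^ 2)
    (fun v v' w => by
      simp only [coframe, coordU, coordV, coordZ, Prod.fst_add, Prod.snd_add, map_add, map_mul,
        Complex.add_re, Complex.add_im, Complex.mul_re, Complex.mul_im]
      ring)
    (fun c v w => by
      simp [coframe, coordU, coordV, coordZ]
      ring)
    (fun v w w' => by
      simp only [coframe, coordU, coordV, coordZ, Prod.fst_add, Prod.snd_add, map_add, map_mul,
        Complex.add_re, Complex.add_im, Complex.mul_re, Complex.mul_im]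
      ring)
    (fun c v w => by
      simp [coframe, coordU, coordV, coordZ]
      ring)

/-- A field of bilinear forms on `ℝ⁴`. -/
abbrev TensorField : Type := Spacetime → LinearMap.BilinForm ℝ Spacetime

/-- The set of points at which `g` has Lorentzian signature `(-,+,+,+)`. -/
def lorentzDomain (g : TensorField) : Set Spacetime :=
  {p | ∃ b : Module.Basis (Fin 4) ℝ Spacetime, ∀ i j, g p (b i) (b j) =
    if i = j then (if i = 0 then -1 else 1) else 0}

/-- The time orientation `T = ∂_U + ∂_V`. -/
def timeOrientation : Spacetime := (1, 1, 0)

/-- `v` is a future directed causal vector at `p`. -/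
def IsFutureCausalVec (g : TensorField) (p v : Spacetime) : Prop :=
  v ≠ 0 ∧ g p v v ≤ 0 ∧ g p timeOrientation v < 0

/-- `γ : I → M` is a future directed causal curve: locally Lipschitz on `I`, with future directed
causal velocity almost everywhere. -/
def IsFutureCausalCurve (M : Set Spacetime) (g : TensorField) (I : Set ℝ)
    (γ : ℝ → Spacetime) : Prop :=
  MapsTo γ I M ∧ LocallyLipschitzOn I γ ∧
    ∀ᵐ t ∂(volume.restrict I), IsFutureCausalVec g (γ t) (deriv γ t)

/-- The length `∫_I √(-g(γ', γ')) dt`. -/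
def curveLength (g : TensorField) (I : Set ℝ) (γ : ℝ → Spacetime) : ℝ≥0∞ :=
  ∫⁻ t in I, ENNReal.ofReal (Real.sqrt (-(g (γ t) (deriv γ t) (deriv γ t))))

/-- The time separation of `(M, g)`: the supremum of the lengths of the future directed causal
curves `[0, 1] → M` from `x` to `y`, and `0` if there are none. -/
def timeSeparation (M : Set Spacetime) (g : TensorField) (x y : Spacetime) : ℝ≥0∞ :=
  sSup {L | ∃ γ : ℝ → Spacetime, IsFutureCausalCurve M g (Icc 0 1) γ ∧ γ 0 = x ∧ γ 1 = y ∧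
    L = curveLength g (Icc 0 1) γ}

/-- The chronological relation `x ≪ y` of `(M, g)`. -/
def Chronological (M : Set Spacetime) (g : TensorField) (x y : Spacetime) : Prop :=
  0 < timeSeparation M g x y

/-- `γ : I → M`, for an interval `I`, is a future directed timelike curve of `(M, g)`,
parametrised by proper time, which maximises length between any two of its points. -/
structure IsTimelikeMaximizer (M : Set Spacetime) (g : TensorField) (I : Set ℝ)
    (γ : ℝ → Spacetime) : Prop where
  causal : IsFutureCausalCurve M g I γ
  timelike_velocity : ∀ᵐ t ∂(volume.restrict I), g (γ t) (deriv γ t) (deriv γ t) < 0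
  chronological : ∀ s ∈ I, ∀ t ∈ I, s < t → Chronological M g (γ s) (γ t)
  proper_time : ∀ s ∈ I, ∀ t ∈ I, s < t → curveLength g (Icc s t) γ = ENNReal.ofReal (t - s)
  maximizing : ∀ s ∈ I, ∀ t ∈ I, s < t →
    curveLength g (Icc s t) γ = timeSeparation M g (γ s) (γ t)

/-- A complete timelike line of `(M, g)`: a timelike curve parametrised by proper time ranging
over all of `ℝ`, which maximises length between any two of its points. -/
def IsTimelikeLine (M : Set Spacetime) (g : TensorField) (γ : ℝ → Spacetime) : Prop :=
  IsTimelikeMaximizer M g univ γ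

/-- The curve `t ↦ (t, t, 0, 0) / √2`. -/
def centralLine (t : ℝ) : Spacetime := (1 / Real.sqrt 2) • ((t, t, 0) : Spacetime)

end ImpulsiveWave

end

open MeasureTheory Set
open scoped ENNReal

namespace ImpulsiveWave

/-! The proof is a calibration argument. For `Λ = 0` the conformal factor is `1`, so `-g(v,v)` is `2
dU(v) dV(v)` minus a nonnegative square, the only term containing the profile. Hence `-g(v,v) ≤ 2
dU(v) dV(v) ≤ (dU(v) + dV(v))² / 2`, and a future directed causal vector has proper time element at
most `lightConeTime v` (`sqrt_neg_waveMetric_le`). This functional is a constant, hence exact,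
one-form, so integration bounds the length of any causal curve by a difference of endpoint values
(`curveLength_le`). Both inequalities are equalities along the central line, where `dZ = 0` and `dU
= dV`. The bound is pointwise and does not use nondegeneracy of `g`, so it holds in every region
`M`; the line is a maximizer as soon as the segment lies in `M`. -/

/-- The functional `(U + V) / √2` on tangent vectors, which calibrates the central line. -/
noncomputable def lightConeTime : Spacetime →L[ℝ] ℝ :=
  (1 / Real.sqrt 2) •
    (ContinuousLinearMap.fst ℝ ℝ (ℝ × ℂ) +
      (ContinuousLinearMap.fst ℝ ℝ ℂ).comp (ContinuousLinearMap.snd ℝ ℝ (ℝ × ℂ)))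

theorem lightConeTime_apply (v : Spacetime) :
    lightConeTime v = 1 / Real.sqrt 2 * (coordU v + coordV v) := rfl

theorem lightConeTime_centralLine (t : ℝ) : lightConeTime (centralLine t) = t := by
  have h : Real.sqrt 2 * Real.sqrt 2 = 2 := Real.mul_self_sqrt (by norm_num)
  have h0 : Real.sqrt 2 ≠ 0 := by positivity
  simp only [lightConeTime_apply, centralLine, coordU, coordV, Prod.smul_fst, Prod.smul_snd,
    smul_eq_mul]
  field_simp
  linear_combination -t * h

theorem waveMetric_zero_self (H : ℂ → ℝ) (p v : Spacetime) :
    waveMetric 0 H p v v = 2 * Complex.normSq (coframe H p v) - 2 * (coordU v * coordV v) := by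
  simp only [waveMetric, LinearMap.mk₂_apply, conformalP, Complex.mul_conj, Complex.ofReal_re]
  ring

theorem coframe_eq_zero (H : ℂ → ℝ) (p : Spacetime) {v : Spacetime} (hv : coordZ v = 0) :
    coframe H p v = 0 := by
  simp [coframe, hv]

/-- The coframe annihilates `∂_U + ∂_V`, so future directedness does not see the profile: it says
that `U + V` increases. -/
theorem waveMetric_zero_timeOrientation (H : ℂ → ℝ) (p v : Spacetime) :
    waveMetric 0 H p timeOrientation v = -(coordU v + coordV v) := by
  simp only [waveMetric, LinearMap.mk₂_apply, conformalP,
    coframe_eq_zero H p (v := timeOrientation) rfl]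
  simp [timeOrientation, coordU, coordV]
  ring

/-- The proper time element of a future directed vector is at most its light cone time. -/
theorem sqrt_neg_waveMetric_le (H : ℂ → ℝ) (p v : Spacetime) (hv : 0 ≤ coordU v + coordV v) :
    Real.sqrt (-(waveMetric 0 H p v v)) ≤ lightConeTime v := by
  rw [lightConeTime_apply, waveMetric_zero_self]
  apply Real.sqrt_le_iff.2 ⟨by positivity, ?_⟩
  rw [mul_pow, div_pow, Real.sq_sqrt (by norm_num)]
  -- With `u`, `v` the `U` and `V` components, `(u + v)² / 2 - 2uv = (u - v)² / 2`.
  nlinarith [Complex.normSq_nonneg (coframe H p v), sq_nonneg (coordU v - coordV v)]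

/-- Every future directed causal curve is at most as long as the light cone time it spends. -/
theorem curveLength_le (H : ℂ → ℝ) {M : Set Spacetime} {γ : ℝ → Spacetime} {a b : ℝ} (hab : a ≤ b)
    (hγ : IsFutureCausalCurve M (waveMetric 0 H) (Icc a b) γ) :
    curveLength (waveMetric 0 H) (Icc a b) γ ≤
      ENNReal.ofReal (lightConeTime (γ b) - lightConeTime (γ a)) := by
  obtain ⟨-, hlip, hae⟩ := hγ
  obtain ⟨K, hK⟩ := hlip.exists_lipschitzOnWith_of_compact isCompact_Icc
  -- Absolute continuity gives the fundamental theorem of calculus for a curve differentiable only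
  -- almost everywhere.
  have hac : AbsolutelyContinuousOnInterval (lightConeTime ∘ γ) a b := by
    apply LipschitzOnWith.absolutelyContinuousOnInterval (K := ‖lightConeTime‖₊ * K)
    rw [uIcc_of_le hab]
    exact lightConeTime.lipschitz.comp_lipschitzOnWith hK
  have hderiv : ∀ᵐ t ∂(volume.restrict (Icc a b)),
      deriv (lightConeTime ∘ γ) t = lightConeTime (deriv γ t) ∧
        0 ≤ coordU (deriv γ t) + coordV (deriv γ t) := by
    filter_upwards [hae] with t ⟨h0, _, h2⟩
    rw [waveMetric_zero_timeOrientation] at h2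
    -- `deriv` takes the value `0` where `γ` is not differentiable, so a nonzero velocity forces
    -- differentiability.
    have hd : DifferentiableAt ℝ γ t := by
      by_contra h
      exact h0 (deriv_zero_of_not_differentiableAt h)
    exact ⟨(lightConeTime.hasFDerivAt.comp_hasDerivAt t hd.hasDerivAt).deriv, by linarith⟩
  have hint : IntegrableOn (deriv (lightConeTime ∘ γ)) (Icc a b) := by
    rw [← intervalIntegrable_iff_integrableOn_Icc_of_le hab]
    exact hac.intervalIntegrable_deriv
  -- Nonnegativity is what lets the lower integral of `ENNReal.ofReal` be computed as a real
  -- integral.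
  have hnonneg : 0 ≤ᵐ[volume.restrict (Icc a b)] deriv (lightConeTime ∘ γ) := by
    filter_upwards [hderiv] with t ⟨h1, h2⟩
    rw [h1, lightConeTime_apply]
    exact mul_nonneg (by positivity) h2
  calc curveLength (waveMetric 0 H) (Icc a b) γ
      ≤ ∫⁻ t in Icc a b, ENNReal.ofReal (deriv (lightConeTime ∘ γ) t) := by
        apply lintegral_mono_ae
        filter_upwards [hderiv] with t ⟨h1, h2⟩
        rw [h1]
        exact ENNReal.ofReal_le_ofReal (sqrt_neg_waveMetric_le H _ _ h2)
    _ = ENNReal.ofReal (∫ t in Icc a b, deriv (lightConeTime ∘ γ) t) :=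
        (ofReal_integral_eq_lintegral_ofReal hint hnonneg).symm
    _ = ENNReal.ofReal (lightConeTime (γ b) - lightConeTime (γ a)) := by
        rw [integral_Icc_eq_integral_Ioc, ← intervalIntegral.integral_of_le hab,
          hac.integral_deriv_eq_sub]
        rfl

theorem timeSeparation_le (H : ℂ → ℝ) (M : Set Spacetime) (x y : Spacetime) :
    timeSeparation M (waveMetric 0 H) x y ≤
      ENNReal.ofReal (lightConeTime y - lightConeTime x) := by
  apply sSup_le
  rintro L ⟨γ, hγ, rfl, rfl, rfl⟩
  exact curveLength_le H zero_le_one hγ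

/-- The velocity of `t ↦ centralLine (s + c * t)`. -/
theorem hasDerivAt_centralLine_affine (s c t : ℝ) :
    HasDerivAt (fun r => centralLine (s + c * r)) (centralLine c) t := by
  have h : HasDerivAt (fun r : ℝ => s + c * r) c t := by
    simpa using ((hasDerivAt_id t).const_mul c).const_add s
  exact (h.prodMk (h.prodMk (hasDerivAt_const t (0 : ℂ)))).const_smul (1 / Real.sqrt 2)

theorem waveMetric_zero_centralLine (H : ℂ → ℝ) (p : Spacetime) (c : ℝ) :
    waveMetric 0 H p (centralLine c) (centralLine c) = -c ^ 2 := by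
  rw [waveMetric_zero_self, coframe_eq_zero H p (by simp [centralLine, coordZ])]
  have h : Real.sqrt 2 ^ 2 = 2 := Real.sq_sqrt (by norm_num)
  have h0 : Real.sqrt 2 ≠ 0 := by positivity
  simp only [centralLine, coordU, coordV, Prod.smul_fst, Prod.smul_snd, smul_eq_mul, map_zero]
  field_simp
  rw [h]
  ring

theorem isFutureCausalVec_centralLine (H : ℂ → ℝ) (p : Spacetime) {c : ℝ} (hc : 0 < c) :
    IsFutureCausalVec (waveMetric 0 H) p (centralLine c) := by
  refine ⟨fun h => ?_, ?_, ?_⟩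
  · have h1 := lightConeTime_centralLine c
    rw [h, map_zero] at h1
    exact hc.ne h1
  · rw [waveMetric_zero_centralLine]
    linarith [sq_nonneg c]
  · rw [waveMetric_zero_timeOrientation]
    simp only [centralLine, coordU, coordV, Prod.smul_fst, Prod.smul_snd, smul_eq_mul]
    have : 0 < 1 / Real.sqrt 2 * c := by positivity
    linarith

/-- The affine family serves twice: `s = 0`, `c = 1` is the line itself, and `c = t - s` on `[0, 1]`
is the competitor joining the points with parameters `s` and `t`. -/
theorem isFutureCausalCurve_centralLine_affine (H : ℂ → ℝ) {M : Set Spacetime} {I : Set ℝ}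
    (s : ℝ) {c : ℝ} (hc : 0 < c) (hM : MapsTo (fun r => centralLine (s + c * r)) I M) :
    IsFutureCausalCurve M (waveMetric 0 H) I (fun r => centralLine (s + c * r)) := by
  refine ⟨hM, ?_, Filter.Eventually.of_forall fun t => ?_⟩
  · have hC : ContDiff ℝ 1 (fun r : ℝ => centralLine (s + c * r)) := by
      unfold centralLine
      fun_prop
    exact hC.locallyLipschitz.locallyLipschitzOn
  · rw [(hasDerivAt_centralLine_affine s c t).deriv]
    exact isFutureCausalVec_centralLine H _ hc

theorem curveLength_centralLine_affine (H : ℂ → ℝ) (s : ℝ) {c : ℝ} (hc : 0 ≤ c) (a b : ℝ) :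
    curveLength (waveMetric 0 H) (Icc a b) (fun r => centralLine (s + c * r)) =
      ENNReal.ofReal (c * (b - a)) := by
  simp only [curveLength, (hasDerivAt_centralLine_affine s c _).deriv,
    waveMetric_zero_centralLine, neg_neg, Real.sqrt_sq hc, lintegral_const,
    Measure.restrict_apply_univ, Real.volume_Icc]
  rw [ENNReal.ofReal_mul hc]

theorem centralLine_eq_affine : centralLine = fun r => centralLine (0 + 1 * r) := by
  simp

theorem timeSeparation_centralLine (H : ℂ → ℝ) {M : Set Spacetime} {s t : ℝ} (hst : s < t)
    (hM : MapsTo centralLine (Icc s t) M) :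
    timeSeparation M (waveMetric 0 H) (centralLine s) (centralLine t) =
      ENNReal.ofReal (t - s) := by
  apply le_antisymm
  · simpa only [lightConeTime_centralLine] using
      timeSeparation_le H M (centralLine s) (centralLine t)
  · have hpos : 0 < t - s := sub_pos.2 hst
    -- `timeSeparation` admits only curves on `[0, 1]`, so the segment is rescaled to run at
    -- constant speed `t - s`.
    refine le_sSup ⟨fun r => centralLine (s + (t - s) * r),
      isFutureCausalCurve_centralLine_affine H s hpos fun r hr => hM ?_, by simp, by simp, ?_⟩
    · constructor <;> nlinarith [hr.1, hr.2]
    · rw [curveLength_centralLine_affine H s hpos.le]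
      simp

/-- The central line maximises length between its points in every region that contains it. -/
theorem isTimelikeMaximizer_centralLine (H : ℂ → ℝ) {M : Set Spacetime} {I : Set ℝ}
    (hI : I.OrdConnected) (hM : MapsTo centralLine I M) :
    IsTimelikeMaximizer M (waveMetric 0 H) I centralLine := by
  have hsep : ∀ s ∈ I, ∀ t ∈ I, s < t →
      timeSeparation M (waveMetric 0 H) (centralLine s) (centralLine t) =
        ENNReal.ofReal (t - s) := fun s hs t ht hst =>
    -- Order-connectedness puts `[s, t]` inside `I`, so the whole segment stays in `M`.
    timeSeparation_centralLine H hst (hM.mono_left (hI.out hs ht))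
  have hlen : ∀ s t : ℝ, curveLength (waveMetric 0 H) (Icc s t) centralLine =
      ENNReal.ofReal (t - s) := fun s t => by
    simpa using curveLength_centralLine_affine H 0 zero_le_one s t
  refine ⟨?_, Filter.Eventually.of_forall fun t => ?_, fun s hs t ht hst => ?_,
    fun s _ t _ _ => hlen s t, fun s hs t ht hst => ?_⟩
  · rw [centralLine_eq_affine] at hM ⊢
    exact isFutureCausalCurve_centralLine_affine H 0 one_pos hM
  · have hd : deriv centralLine t = centralLine 1 := by
      simpa using (hasDerivAt_centralLine_affine 0 1 t).deriv
    rw [hd, waveMetric_zero_centralLine]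
    norm_num
  · rw [Chronological, hsep s hs t ht hst]
    exact ENNReal.ofReal_pos.2 (sub_pos.2 hst)
  · rw [hlen, hsep s hs t ht hst]

end ImpulsiveWave

theorem mainTheorem10 (H : ℂ → ℝ) (hH : ImpulsiveWave.IsC31Loc H) :
    ImpulsiveWave.IsTimelikeLine Set.univ (ImpulsiveWave.waveMetric 0 H)
        ImpulsiveWave.centralLine ∧
      ∀ I : Set ℝ, I.OrdConnected →
        Set.MapsTo ImpulsiveWave.centralLine I
          (ImpulsiveWave.lorentzDomain (ImpulsiveWave.waveMetric 0 H)) →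
        ImpulsiveWave.IsTimelikeMaximizer
          (ImpulsiveWave.lorentzDomain (ImpulsiveWave.waveMetric 0 H))
          (ImpulsiveWave.waveMetric 0 H) I ImpulsiveWave.centralLine := by
  exact ⟨ImpulsiveWave.isTimelikeMaximizer_centralLine H Set.ordConnected_univ (Set.mapsTo_univ _ _),
    fun _ hI hM => ImpulsiveWave.isTimelikeMaximizer_centralLine H hI hM⟩
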